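/- Metric spaces are allowed to have infinite distances. The length of a continuous curve $\gamma:[a,b]\to X$ in a metric space $(X,d)$ is the supremum of the sums $\sum_i d(\gamma(t_i),\gamma(t_{i+1}))$ over all finite selections $a=t_0\le t_1\le\cdots\le t_n=b$; the intrinsic metric $d_\ell(x,y)$ is the infimum of the lengths of the continuous curves from $x$ to $y$ ($\infty$ if there is none); and $(X,d)$ is a path (intrinsic) metric space if $d=d_\ell$. Let $\mathbf{CPMet}$ be the category of complete path metric spaces and non-expansive ($1$-Lipschitz) maps, enriched over itself by the internal hom $[X,Y]$: the set of non-expansive maps $X\to Y$ with the intrinsic metric $d_{\sup,\ell}$ attached to the supremum metric $d_{\sup}(f,g)=\sup_{x\in X}d_Y(f(x),g(x))$. An object $X$ of $\mathbf{CPMet}$ is isometry-$\aleph_0$-generated in the enriched sense if the functor $[X,-]:\mathbf{CPMet}\to\mathbf{CPMet}$ preserves the colimits of all diagrams of isometries (distance-preserving maps) indexed by $\aleph_0$-directed posets, i.e. posets in which every finite subset has an upper bound. Theorem. The objects of $\mathbf{CPMet}$ that are isometry-$\aleph_0$-generated in the enriched sense are precisely the finite discrete metric spaces, that is, the finite sets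 (possibly empty) in which any two distinct points are at infinite distance. -/

import Mathlib

open CategoryTheory CategoryTheory.Limits Filter Topology Set
open scoped ENNReal NNReal unitInterval

universe u

/-! ### Lengths of curves and the intrinsic metric -/

/-- The length of a continuous curve: the supremum of the sums of distances between consecutive
points over all finite monotone selections of parameters. -/
noncomputable def Path.len {X : Type*} [EMetricSpace X] {x y : X} (γ : Path x y) : ℝ≥0∞ :=
  eVariationOn (fun t : I => γ t) univ

/-- The intrinsic distance `d_ℓ`: the infimum of the lengths of curves from `x` to `y`
(`∞` if there is none). -/
noncomputable def pathEDist {X : Type*} [EMetricSpace X] (x y : X) : ℝ≥0∞ :=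
  ⨅ γ : Path x y, γ.len

/-- A path (or length, or intrinsic) metric space: `d = d_ℓ`. Distances may be infinite. -/
def IsPathMetric (X : Type*) [EMetricSpace X] : Prop :=
  ∀ x y : X, edist x y = pathEDist x y

section PathLemmas

variable {X : Type*} [EMetricSpace X]

theorem Path.edist_le_len {x y : X} (γ : Path x y) (s t : I) : edist (γ s) (γ t) ≤ γ.len :=
  eVariationOn.edist_le (fun t : I => γ t) (mem_univ s) (mem_univ t)

theorem edist_le_pathEDist (x y : X) : edist x y ≤ pathEDist x y :=
  le_iInf fun γ => by simpa using γ.edist_le_len 0 1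

theorem Path.len_refl (x : X) : (Path.refl x).len = 0 :=
  (eVariationOn.eq_zero_iff _).2 fun _ _ _ _ => edist_self x

theorem pathEDist_self (x : X) : pathEDist x x = 0 :=
  le_antisymm ((iInf_le _ (Path.refl x)).trans (Path.len_refl x).le) bot_le

theorem Path.len_symm_le {x y : X} (γ : Path x y) : γ.symm.len ≤ γ.len :=
  eVariationOn.comp_le_of_antitoneOn (fun t : I => γ t) (t := univ) (s := univ) unitInterval.symm
    (fun _ _ _ _ h => unitInterval.strictAnti_symm.antitone h) (mapsTo_univ _ _)

theorem pathEDist_comm_le (x y : X) : pathEDist x y ≤ pathEDist y x :=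
  le_iInf fun γ => (iInf_le _ γ.symm).trans γ.len_symm_le

theorem Path.len_trans_le {x y z : X} (γ : Path x y) (γ' : Path y z) :
    (γ.trans γ').len ≤ γ.len + γ'.len := by
  let h : I := ⟨1 / 2, by norm_num, by norm_num⟩
  have hu : (univ : Set I) = Iic h ∪ Ici h := Iic_union_Ici.symm
  unfold Path.len
  rw [hu, eVariationOn.union (x := h) _ isGreatest_Iic isLeast_Ici, ← hu]
  gcongr
  · let φ : I → I := fun t => projIcc 0 1 zero_le_one (2 * (t : ℝ))
    have hφ : MonotoneOn φ (Iic h) := fun a _ b _ hab =>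
      monotone_projIcc _ (by have : (a : ℝ) ≤ b := hab; linarith)
    refine le_trans (le_of_eq ?_)
      (eVariationOn.comp_le_of_monotoneOn (fun t : I => γ t) φ hφ (mapsTo_univ _ _))
    refine eVariationOn.congr fun t ht => ?_
    have ht' : (t : ℝ) ≤ 1 / 2 := ht
    simp only [Path.trans_apply, dif_pos ht', Function.comp, φ]
    congr 1
    exact (projIcc_of_mem _ ⟨by have := t.2.1; linarith, by linarith⟩).symm
  · let φ : I → I := fun t => projIcc 0 1 zero_le_one (2 * (t : ℝ) - 1)
    have hφ : MonotoneOn φ (Ici h) := fun a _ b _ hab =>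
      monotone_projIcc _ (by have : (a : ℝ) ≤ b := hab; linarith)
    refine le_trans (le_of_eq ?_)
      (eVariationOn.comp_le_of_monotoneOn (fun t : I => γ' t) φ hφ (mapsTo_univ _ _))
    refine eVariationOn.congr fun t ht => ?_
    have ht' : 1 / 2 ≤ (t : ℝ) := ht
    have hm : (2 * (t : ℝ) - 1) ∈ Icc (0 : ℝ) 1 := ⟨by linarith, by have := t.2.2; linarith⟩
    simp only [Function.comp, φ, projIcc_of_mem _ hm]
    rcases ht'.eq_or_lt with h0 | h0
    · have e1 : (γ.trans γ') t = y := by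
        rw [Path.trans_apply, dif_pos h0.ge]
        convert! γ.target
        rw [← h0]; norm_num
      rw [e1]
      symm
      convert! γ'.source
      rw [← h0]; norm_num
    · rw [Path.trans_apply, dif_neg (not_le.2 h0)]

theorem pathEDist_triangle (x y z : X) : pathEDist x z ≤ pathEDist x y + pathEDist y z := by
  unfold pathEDist
  exact ENNReal.le_iInf_add_iInf fun γ γ' => (iInf_le _ (γ.trans γ')).trans (γ.len_trans_le γ')

theorem pathEDist_le_of_lipschitz {Y : Type*} [EMetricSpace Y] {f : X → Y}
    (hf : LipschitzWith 1 f) (x x' : X) : pathEDist (f x) (f x') ≤ pathEDist x x' :=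
  le_iInf fun γ => (iInf_le _ (γ.map hf.continuous)).trans <| by
    refine iSup_mono fun p => Finset.sum_le_sum fun i _ => ?_
    simpa using hf (γ (p.2.1 (i + 1))) (γ (p.2.1 i))

theorem pathEDist_le_variation {x y : X} (γ : Path x y) {a b : I} (hab : a ≤ b) :
    pathEDist (γ a) (γ b) ≤ eVariationOn (fun t : I => γ t) (Icc a b) := by
  let φ : I → I := fun t => projIcc 0 1 zero_le_one ((1 - t) * a + t * b : ℝ)
  have hmem : ∀ t : I, ((1 - t) * a + t * b : ℝ) ∈ Icc (a : ℝ) b := fun t => by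
    have h1 := t.2.1
    have h2 := t.2.2
    have h3 : (a : ℝ) ≤ b := hab
    constructor <;> nlinarith
  have hval : ∀ t : I, ((φ t : I) : ℝ) = (1 - t) * a + t * b := fun t => by
    have h := hmem t
    have h01 : ((1 - t) * a + t * b : ℝ) ∈ Icc (0 : ℝ) 1 := ⟨a.2.1.trans h.1, h.2.trans b.2.2⟩
    simp only [φ, projIcc_of_mem _ h01]
  have hcont : Continuous φ := by
    have : Continuous fun t : I => ((1 - t) * a + t * b : ℝ) := by fun_prop
    exact continuous_induced_rng.2 (this.congr fun t => (hval t).symm)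
  have hmono : Monotone φ := fun s t hst => by
    have h : (s : ℝ) ≤ t := hst
    have h3 : (a : ℝ) ≤ b := hab
    refine Subtype.coe_le_coe.1 ?_
    rw [hval, hval]
    nlinarith
  have h0 : φ 0 = a := Subtype.ext (by rw [hval]; simp)
  have h1 : φ 1 = b := Subtype.ext (by rw [hval]; simp)
  let δ : Path (γ a) (γ b) :=
    { toFun := fun t => γ (φ t)
      continuous_toFun := γ.continuous.comp hcont
      source' := by rw [h0]
      target' := by rw [h1] }
  refine (iInf_le _ δ).trans ?_
  refine eVariationOn.comp_le_of_monotoneOn (fun t : I => γ t) φ (hmono.monotoneOn _) fun t _ => ?_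
  have := hmem t
  exact ⟨Subtype.coe_le_coe.1 (by rw [hval]; exact this.1),
    Subtype.coe_le_coe.1 (by rw [hval]; exact this.2)⟩

/-- Concatenation of the paths `γ k, …, γ (k + n - 1)`. -/
noncomputable def concatPath {v : ℕ → X} (γ : ∀ k, Path (v k) (v (k + 1))) :
    ∀ n k : ℕ, Path (v k) (v (k + n))
  | 0, k => Path.refl (v k)
  | n + 1, k => (γ k).trans ((concatPath γ n (k + 1)).cast rfl (by congr 1; omega))

theorem pathEDist_le_of_tendsto [CompleteSpace X] {v : ℕ → X} {x : X}
    (γ : ∀ k, Path (v k) (v (k + 1))) (hγ : ∀ k, (γ k).len ≤ 2⁻¹ ^ k)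
    (hx : Tendsto v atTop (𝓝 x)) (k : ℕ) : pathEDist (v k) x ≤ 2 * 2⁻¹ ^ k := by
  have hlen : ∀ n k, (concatPath γ n k).len ≤ 2 * 2⁻¹ ^ k := by
    intro n
    induction n with
    | zero => intro k; exact (Path.len_refl (v k)).le.trans bot_le
    | succ n ih =>
      intro k
      refine (Path.len_trans_le _ _).trans ((add_le_add (hγ k) (ih (k + 1))).trans (le_of_eq ?_))
      rw [pow_succ, mul_left_comm, ENNReal.mul_inv_cancel two_ne_zero ENNReal.ofNat_ne_top, mul_one,
        two_mul]
  have hstep : ∀ n k t, edist (concatPath γ n k t) (concatPath γ (n + 1) k t) ≤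
      2⁻¹ ^ k * 2⁻¹ ^ n := by
    intro n
    induction n with
    | zero =>
      intro k t
      change edist (v k) (((γ k).trans ((Path.refl (v (k + 1))).cast _ _)) t) ≤ _
      rw [pow_zero, mul_one, Path.trans_apply]
      refine le_trans ?_ (hγ k)
      split_ifs with h
      · simpa using (γ k).edist_le_len 0 _
      · simpa using (γ k).edist_le_len 0 1
    | succ n ih =>
      intro k t
      change edist (((γ k).trans ((concatPath γ n (k + 1)).cast _ _)) t)
        (((γ k).trans ((concatPath γ (n + 1) (k + 1)).cast _ _)) t) ≤ _
      rw [Path.trans_apply, Path.trans_apply]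
      split_ifs with h
      · simp
      · refine (ih (k + 1) _).trans (le_of_eq ?_)
        rw [pow_succ, pow_succ, mul_assoc, mul_comm (2⁻¹ : ℝ≥0∞) (2⁻¹ ^ n)]
  have hB : (2⁻¹ ^ k : ℝ≥0∞) ≠ ⊤ := ENNReal.pow_ne_top (by simp)
  have hr : (2⁻¹ : ℝ≥0∞) < 1 := by simp
  have hlim : ∀ t : I, ∃ a, Tendsto (fun n => concatPath γ n k t) atTop (𝓝 a) := fun t =>
    cauchySeq_tendsto_of_complete
      (cauchySeq_of_edist_le_geometric _ _ hr hB fun n => hstep n k t)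
  choose g hg using hlim
  have hunif : TendstoUniformly (fun n t => concatPath γ n k t) g atTop := by
    rw [EMetric.tendstoUniformly_iff]
    intro ε hε
    have hz : Tendsto (fun n : ℕ => (2⁻¹ ^ k : ℝ≥0∞) * 2⁻¹ ^ n / (1 - 2⁻¹)) atTop (𝓝 0) := by
      have h1 : Tendsto (fun n : ℕ => (2⁻¹ : ℝ≥0∞) ^ n) atTop (𝓝 0) :=
        ENNReal.tendsto_pow_atTop_nhds_zero_of_lt_one hr
      have h2 := ENNReal.Tendsto.const_mul (a := 2⁻¹ ^ k) h1 (Or.inr hB)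
      have h3 := ENNReal.Tendsto.div_const (b := 1 - 2⁻¹) h2 (Or.inr (by simp))
      simpa using h3
    filter_upwards [hz.eventually_lt_const hε] with n hn t
    rw [edist_comm]
    exact (edist_le_of_edist_le_geometric_of_tendsto _ _ (fun n => hstep n k t) (hg t) n).trans_lt
      hn
  have hgc : Continuous g :=
    hunif.continuous (Frequently.of_forall fun n => (concatPath γ n k).continuous)
  let δ : Path (v k) x :=
    { toFun := g
      continuous_toFun := hgc
      source' := tendsto_nhds_unique (hg 0) (by simp)
      target' := tendsto_nhds_unique (hg 1) (by
        simpa using hx.comp (tendsto_add_atTop_nat k) |>.congr fun n => by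
          simp [Function.comp, add_comm]) }
  refine (iInf_le _ δ).trans ?_
  by_contra hcon
  rw [not_le] at hcon
  obtain ⟨n, hn⟩ := (eVariationOn.lowerSemicontinuous_aux
    (F := fun n (t : I) => concatPath γ n k t) (p := atTop) (s := univ)
    (f := fun t : I => δ t) (fun t _ => hg t) hcon).exists
  exact absurd (hlen n k) (not_le.2 hn)

end PathLemmas

/-- The space `(X, d_ℓ)`: the same points as `X`, with the intrinsic metric. -/
def LengthSpace (X : Type u) : Type u := X

section LengthSpace

variable {X : Type u} [EMetricSpace X]

noncomputable instance : EMetricSpace (LengthSpace X) where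
  edist x y := pathEDist (X := X) x y
  edist_self := pathEDist_self (X := X)
  edist_comm x y := le_antisymm (pathEDist_comm_le (X := X) x y) (pathEDist_comm_le (X := X) y x)
  edist_triangle := pathEDist_triangle (X := X)
  eq_of_edist_eq_zero {x y} h :=
    eq_of_edist_eq_zero (α := X) (le_antisymm ((edist_le_pathEDist (X := X) x y).trans h.le) bot_le)

theorem LengthSpace.edist_def (x y : LengthSpace X) : edist x y = pathEDist (X := X) x y := rfl

instance [CompleteSpace X] : CompleteSpace (LengthSpace X) := by
  refine EMetric.complete_of_convergent_controlled_sequences (fun n => 2⁻¹ ^ n)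
    (fun n => ENNReal.pow_pos (by simp) n) fun v hv => ?_
  have h1 : ∀ k, pathEDist (X := X) (v k) (v (k + 1)) < 2⁻¹ ^ k := fun k => hv k k (k + 1) le_rfl
    (Nat.le_succ k)
  have h2 : ∀ k, ∃ γ : Path (X := X) (v k) (v (k + 1)), γ.len < 2⁻¹ ^ k :=
    fun k => iInf_lt_iff.1 (h1 k)
  choose γ hγ using h2
  obtain ⟨x, hx⟩ := cauchySeq_tendsto_of_complete (α := X) (u := v)
    (cauchySeq_of_edist_le_geometric 2⁻¹ 1 (by simp) (by simp) fun n => by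
      rw [one_mul]
      exact (edist_le_pathEDist (X := X) _ _).trans (h1 n).le)
  refine ⟨x, EMetric.tendsto_atTop.2 fun ε hε => ?_⟩
  have hz : Tendsto (fun n : ℕ => (2 : ℝ≥0∞) * 2⁻¹ ^ n) atTop (𝓝 0) := by
    simpa using ENNReal.Tendsto.const_mul (a := 2)
      (ENNReal.tendsto_pow_atTop_nhds_zero_of_lt_one (r := 2⁻¹) (by simp)) (Or.inr (by simp))
  obtain ⟨N, hN⟩ := (hz.eventually_lt_const hε).exists_forall_of_atTop
  exact ⟨N, fun n hn =>
    (pathEDist_le_of_tendsto (X := X) γ (fun k => (hγ k).le) hx n).trans_lt (hN n hn)⟩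

theorem LengthSpace.pathEDist_le_len (x y : X) (γ : Path x y) :
    pathEDist (X := LengthSpace X) x y ≤ γ.len := by
  by_cases hfin : γ.len = ⊤
  · exact hfin ▸ le_top
  have hbv : BoundedVariationOn (fun t : I => γ t) univ := hfin
  let g : I → LengthSpace X := fun t => γ t
  have hle : ∀ a b : I, a ≤ b →
      edist (g a) (g b) ≤ eVariationOn (fun t : I => γ t) (Icc a b) :=
    fun a b hab => pathEDist_le_variation γ hab
  have hcont : Continuous g := by
    rw [continuous_iff_continuousAt]
    intro a
    have hL := hbv.tendsto_eVariationOn_Icc_zero_left (x := a)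
      γ.continuous.continuousWithinAt
    have hR := hbv.tendsto_eVariationOn_Icc_zero_right a γ.continuous.continuousWithinAt
    simp only [univ_inter, nhdsWithin_univ] at hL hR
    refine EMetric.tendsto_nhds.2 fun ε hε => ?_
    filter_upwards [hL.eventually_lt_const hε, hR.eventually_lt_const hε] with t h1 h2
    rcases le_total t a with h | h
    · exact (hle t a h).trans_lt h1
    · rw [edist_comm]
      exact (hle a t h).trans_lt h2
  let δ : @Path (LengthSpace X) _ x y :=
    { toFun := g
      continuous_toFun := hcont
      source' := γ.source
      target' := γ.target }
  refine (iInf_le _ δ).trans (iSup_le ?_)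
  rintro ⟨n, s, hs, -⟩
  calc ∑ i ∈ Finset.range n, edist (g (s (i + 1))) (g (s i))
      ≤ ∑ i ∈ Finset.range n, eVariationOn (fun t : I => γ t) (Icc (s i) (s (i + 1))) :=
        Finset.sum_le_sum fun i _ => by
          rw [edist_comm]
          exact hle _ _ (hs (Nat.le_succ i))
    _ = eVariationOn (fun t : I => γ t) (Icc (s 0) (s n)) := eVariationOn.sum' _ hs
    _ ≤ γ.len := eVariationOn.mono _ (subset_univ _)

theorem LengthSpace.isPathMetric : IsPathMetric (LengthSpace X) := fun x y =>
  le_antisymm (edist_le_pathEDist x y)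
    (le_iInf fun γ => LengthSpace.pathEDist_le_len (X := X) x y γ)

end LengthSpace

/-! ### Contractions with the supremum distance -/

/-- Non-expansive (1-Lipschitz) maps. -/
@[ext]
structure Contraction (X Y : Type u) [EMetricSpace X] [EMetricSpace Y] where
  toFun : X → Y
  lipschitz : LipschitzWith 1 toFun

namespace Contraction

variable {X Y Z : Type u} [EMetricSpace X] [EMetricSpace Y] [EMetricSpace Z]

/-- The identity contraction. -/
def id (X : Type u) [EMetricSpace X] : Contraction X X := ⟨fun x => x, LipschitzWith.id⟩

/-- Composition, in diagrammatic order. -/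
def comp (f : Contraction X Y) (g : Contraction Y Z) : Contraction X Z :=
  ⟨fun x => g.toFun (f.toFun x), (g.lipschitz.comp f.lipschitz).weaken (one_mul 1).le⟩

/-- The supremum distance `d_sup (f, g) = sup_x d (f x, g x)`. -/
noncomputable instance : EMetricSpace (Contraction X Y) where
  edist f g := ⨆ x, edist (f.toFun x) (g.toFun x)
  edist_self f := by simp
  edist_comm f g := by simp [edist_comm]
  edist_triangle f g h := iSup_le fun x => (edist_triangle _ (g.toFun x) _).trans
    (add_le_add (le_iSup (fun x => edist (f.toFun x) (g.toFun x)) x)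
      (le_iSup (fun x => edist (g.toFun x) (h.toFun x)) x))
  eq_of_edist_eq_zero {f g} h := by
    ext x
    exact edist_eq_zero.1 (le_antisymm
      ((le_iSup (fun x => edist (f.toFun x) (g.toFun x)) x).trans h.le) bot_le)

theorem edist_def (f g : Contraction X Y) :
    edist f g = ⨆ x, edist (f.toFun x) (g.toFun x) := rfl

theorem edist_apply_le (f g : Contraction X Y) (x : X) :
    edist (f.toFun x) (g.toFun x) ≤ edist f g :=
  le_iSup (fun x => edist (f.toFun x) (g.toFun x)) x

instance [CompleteSpace Y] : CompleteSpace (Contraction X Y) := by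
  refine EMetric.complete_of_convergent_controlled_sequences (fun n => 2⁻¹ ^ n)
    (fun n => ENNReal.pow_pos (by simp) n) fun v hv => ?_
  have hstep : ∀ x n, edist ((v n).toFun x) ((v (n + 1)).toFun x) ≤ 1 * 2⁻¹ ^ n := fun x n => by
    rw [one_mul]
    exact (edist_apply_le _ _ x).trans (hv n n (n + 1) le_rfl (Nat.le_succ n)).le
  have hlim : ∀ x, ∃ a, Tendsto (fun n => (v n).toFun x) atTop (𝓝 a) := fun x =>
    cauchySeq_tendsto_of_complete
      (cauchySeq_of_edist_le_geometric 2⁻¹ 1 (by simp) (by simp) (hstep x))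
  choose g hg using hlim
  have hgl : LipschitzWith 1 g := fun x y =>
    le_of_tendsto (Tendsto.edist (hg x) (hg y)) (Eventually.of_forall fun n => (v n).lipschitz x y)
  refine ⟨⟨g, hgl⟩, EMetric.tendsto_atTop.2 fun ε hε => ?_⟩
  have hz : Tendsto (fun n : ℕ => (1 : ℝ≥0∞) * 2⁻¹ ^ n / (1 - 2⁻¹)) atTop (𝓝 0) := by
    have h3 := ENNReal.Tendsto.div_const (b := 1 - 2⁻¹)
      (ENNReal.tendsto_pow_atTop_nhds_zero_of_lt_one (r := 2⁻¹) (by simp)) (Or.inr (by simp))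
    simpa using h3
  obtain ⟨N, hN⟩ := (hz.eventually_lt_const hε).exists_forall_of_atTop
  exact ⟨N, fun n hn => (iSup_le fun x =>
    edist_le_of_edist_le_geometric_of_tendsto _ _ (hstep x) (hg x) n).trans_lt (hN n hn)⟩

theorem lipschitz_postcomp (g : Contraction Y Z) :
    LipschitzWith 1 (fun f : Contraction X Y => f.comp g) := fun f f' => by
  rw [ENNReal.coe_one, one_mul]
  refine iSup_le fun x => ?_
  refine (g.lipschitz (f.toFun x) (f'.toFun x)).trans ?_
  rw [ENNReal.coe_one, one_mul]
  exact edist_apply_le f f' x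

end Contraction

/-! ### The category of complete path metric spaces and its internal hom -/

/-- Complete path metric spaces; distances may be infinite. -/
structure CPMet : Type (u + 1) where
  carrier : Type u
  [emetric : EMetricSpace carrier]
  [complete : CompleteSpace carrier]
  isPathMetric : IsPathMetric carrier

namespace CPMet

attribute [instance] CPMet.emetric CPMet.complete

/-- Morphisms are the non-expansive maps. -/
instance : Category CPMet.{u} where
  Hom X Y := Contraction X.carrier Y.carrier
  id X := Contraction.id X.carrier
  comp f g := Contraction.comp f g

/-- The isometries: morphisms that preserve distances. -/
def isometries : MorphismProperty CPMet.{u} :=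
  fun X Y (f : Contraction X.carrier Y.carrier) => Isometry f.toFun

/-- The internal hom `[X, Y]`: all non-expansive maps, with the intrinsic metric `d_{sup,ℓ}`
attached to the supremum metric. -/
noncomputable def homObj (X Y : CPMet.{u}) : CPMet.{u} where
  carrier := LengthSpace (Contraction X.carrier Y.carrier)
  isPathMetric := LengthSpace.isPathMetric

/-- The enriched hom functor `[X, -]`, acting on morphisms by post-composition. -/
noncomputable def enrichedHom (X : CPMet.{u}) : CPMet.{u} ⥤ CPMet.{u} where
  obj Y := homObj X Y
  map {Y Z} (g : Contraction Y.carrier Z.carrier) :=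
    { toFun := fun f : Contraction X.carrier Y.carrier => f.comp g
      lipschitz := fun f f' => by
        rw [ENNReal.coe_one, one_mul]
        exact pathEDist_le_of_lipschitz (Contraction.lipschitz_postcomp g)
          (show Contraction X.carrier Y.carrier from f) f' }

end CPMet

/-- A poset is `κ`-directed if every subset of cardinality `< κ` has an upper bound. -/
def IsKappaDirected (κ : Cardinal.{u}) (J : Type u) [PartialOrder J] : Prop :=
  ∀ S : Set J, Cardinal.mk S < κ → BddAbove S

/-- `X` is `M`-`κ`-generated in the enriched sense: the functor `[X, -]` preserves colimits of
diagrams of morphisms in `M` indexed by `κ`-directed posets. -/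
def CPMet.IsEnrichedGenerated (M : MorphismProperty CPMet.{u}) (κ : Cardinal.{u})
    (X : CPMet.{u}) : Prop :=
  ∀ (J : Type u) [PartialOrder J], IsKappaDirected κ J →
    ∀ F : J ⥤ CPMet.{u}, (∀ (i j : J) (f : i ⟶ j), M (F.map f)) →
      PreservesColimit F X.enrichedHom

/-- Discrete metric spaces: all distances between distinct points are infinite. -/
def IsDiscreteMetric (X : Type*) [EMetricSpace X] : Prop :=
  ∀ x y : X, x ≠ y → edist x y = ⊤

/-! ### Lipschitz paths and the intrinsic distance -/

section LipschitzPaths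

variable {X : Type*} [EMetricSpace X]

/-! Over a directed poset, a cocone on a diagram of isometries is a colimit exactly when its legs
are isometries with jointly dense ranges (`isometry_leg`, `dense_iUnion_range_leg`,
`nonempty_isColimit`). If `X` is finite and discrete, `[X, Y]` is a finite power of `Y` whose
supremum metric is already intrinsic, and finite powers preserve both properties.

Conversely, let `X` be generated. If `C` is the closure of a directed union of closed path metric
subspaces, every map `X → C` is approximated, in the intrinsic metric of the hom space, by maps into
one of the subspaces (`exists_pathEDist_lt`). This is applied to two spaces.

The discrete space of finite-distance components is the union of its finite subsets; approximating
the quotient map shows that there are finitely many components.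

The torus of circles with circumferences tending to zero is the closure of the union of its finite
subproducts. Suppose `p ≠ q` are at finite distance `R`, and wrap the truncated distance `r` from
`p` around every circle. An approximating map is zero in some coordinate `j`, so a short path of
maps contracts `r` modulo the `j`-th circumference to zero. Lifted to the line, it gives a small `δ`
such that `r + δ` takes values in a discrete group. Then `r + δ` is constant along a path from `p`
to `q`, although `r` changes by `R`. Supremum distance alone would not suffice: a small circle is
uniformly close to a point, but contracting a map around it takes a long path. Hence `X` is
discrete, and its components are its points. -/

theorem Path.len_le_of_lipschitz {x y : X} (γ : Path x y) {K : ℝ≥0} (h : LipschitzWith K γ) :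
    γ.len ≤ K := by
  have h1 : eVariationOn (fun t : I => (t : ℝ)) (univ ∩ Icc 0 1) ≤
      ENNReal.ofReal (((1 : I) : ℝ) - ((0 : I) : ℝ)) :=
    (MonotoneOn.eVariationOn_eq (f := fun t : I => (t : ℝ)) (fun _ _ _ _ h => h)
      (mem_univ _) (mem_univ _)).le
  have h2 : eVariationOn (fun t : I => t) univ ≤ 1 := by
    refine le_trans (le_of_eq ?_) (h1.trans (by simp))
    rw [univ_inter, show Icc (0 : I) 1 = univ from Icc_bot_top]
    rfl
  calc γ.len ≤ K * eVariationOn (fun t : I => t) univ :=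
        (h.lipschitzOnWith (s := univ)).comp_eVariationOn_le (g := fun t : I => t)
          (mapsTo_univ _ _)
    _ ≤ K := by simpa using mul_le_mul_right h2 (K : ℝ≥0∞)

theorem pathEDist_le_of_lipschitz_path {x y : X} (γ : Path x y) {K : ℝ≥0}
    (h : LipschitzWith K γ) : pathEDist x y ≤ K :=
  (iInf_le _ γ).trans (γ.len_le_of_lipschitz h)

/-- An increment of arc length is the variation over the interval between, which shrinks to zero
with the interval because the path is continuous of finite length. -/
theorem Path.continuous_variationOnFromTo {x y : X} (γ : Path x y) (hfin : γ.len ≠ ⊤) :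
    Continuous (variationOnFromTo (fun t : I => γ t) univ 0) := by
  have hbv : BoundedVariationOn (fun t : I => γ t) univ := hfin
  have hle : ∀ a b : I, a ≤ b → edist (variationOnFromTo (fun t : I => γ t) univ 0 a)
      (variationOnFromTo (fun t : I => γ t) univ 0 b) ≤
        eVariationOn (fun t : I => γ t) (Icc a b) := by
    intro a b hab
    have h0 := variationOnFromTo.add hbv.locallyBoundedVariationOn (mem_univ (0 : I))
      (mem_univ a) (mem_univ b)
    have hne : eVariationOn (fun t : I => γ t) (Icc a b) ≠ ⊤ :=
      ne_top_of_le_ne_top hfin (eVariationOn.mono _ (subset_univ _))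
    rw [← h0, edist_dist, Real.dist_eq, sub_add_cancel_left, abs_neg,
      abs_of_nonneg (variationOnFromTo.nonneg_of_le _ _ hab),
      variationOnFromTo.eq_of_le _ _ hab, univ_inter, ENNReal.ofReal_toReal hne]
  rw [continuous_iff_continuousAt]
  intro a
  have hL := hbv.tendsto_eVariationOn_Icc_zero_left (x := a) γ.continuous.continuousWithinAt
  have hR := hbv.tendsto_eVariationOn_Icc_zero_right a γ.continuous.continuousWithinAt
  simp only [univ_inter, nhdsWithin_univ] at hL hR
  refine EMetric.tendsto_nhds.2 fun ε hε => ?_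
  filter_upwards [hL.eventually_lt_const hε, hR.eventually_lt_const hε] with t h1 h2
  rcases le_total t a with h | h
  · exact (hle t a h).trans_lt h1
  · rw [edist_comm]
    exact (hle a t h).trans_lt h2

/-- A rectifiable path has a reparametrization whose Lipschitz constant is its length. -/
theorem Path.exists_lipschitz {x y : X} (γ : Path x y) {K : ℝ≥0} (hK : γ.len ≤ K) :
    ∃ δ : Path x y, LipschitzWith K δ := by
  have hfin : γ.len ≠ ⊤ := ne_top_of_le_ne_top ENNReal.coe_ne_top hK
  have hbv : LocallyBoundedVariationOn (fun t : I => γ t) univ :=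
    BoundedVariationOn.locallyBoundedVariationOn hfin
  set V := variationOnFromTo (fun t : I => γ t) univ (0 : I) with hV
  set p := naturalParameterization (fun t : I => γ t) univ (0 : I) with hp
  have hV0 : V 0 = 0 := variationOnFromTo.self _ _ _
  have hV1 : V 1 = γ.len.toReal := by
    rw [hV, variationOnFromTo.eq_of_le _ _ zero_le_one, univ_inter,
      show Icc (0 : I) 1 = univ from Icc_bot_top]
    rfl
  have hVK : V 1 ≤ K := by
    rw [hV1]
    exact ENNReal.toReal_le_of_le_ofReal K.2 (by simpa using hK)
  have hV1' : 0 ≤ V 1 := hV1 ▸ ENNReal.toReal_nonneg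
  have hpV : ∀ t, p (V t) = γ t := fun t => by
    simpa using edist_naturalParameterization_eq_zero hbv (mem_univ 0) (mem_univ t)
  have hs := has_unit_speed_naturalParameterization _ hbv (mem_univ (0 : I))
  -- The natural parameterization has unit speed only on the range of arc length; by the
  -- intermediate value theorem this contains all of `[0, V 1]`.
  have himg : ∀ t : I, (t : ℝ) * V 1 ∈ V '' univ := fun t => by
    have h := intermediate_value_Icc (zero_le_one (α := I))
      (γ.continuous_variationOnFromTo hfin).continuousOn
    rw [← hV, hV0] at h
    exact image_mono (subset_univ _) (h ⟨mul_nonneg t.2.1 hV1',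
      mul_le_of_le_one_left hV1' t.2.2⟩)
  have hlip : ∀ s t : I, s ≤ t →
      edist (p ((s : ℝ) * V 1)) (p ((t : ℝ) * V 1)) ≤ K * edist s t := by
    intro s t hst
    have hst' : (s : ℝ) ≤ t := hst
    have hm : (s : ℝ) * V 1 ≤ t * V 1 := mul_le_mul_of_nonneg_right hst' hV1'
    refine (eVariationOn.edist_le (s := V '' univ ∩ Icc ((s : ℝ) * V 1) (t * V 1)) _
      ⟨himg s, left_mem_Icc.2 hm⟩ ⟨himg t, right_mem_Icc.2 hm⟩).trans ?_
    rw [hs (himg s) (himg t), NNReal.coe_one, one_mul, ← sub_mul, edist_comm s t,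
      Subtype.edist_eq, edist_dist, Real.dist_eq, abs_of_nonneg (sub_nonneg.2 hst'),
      ENNReal.ofReal_mul (sub_nonneg.2 hst'), mul_comm]
    gcongr
    simpa using ENNReal.ofReal_le_ofReal hVK
  have hlip' : LipschitzWith K fun t : I => p ((t : ℝ) * V 1) := fun s t => by
    rcases le_total s t with h | h
    · exact hlip s t h
    · rw [edist_comm, edist_comm s t]
      exact hlip t s h
  refine ⟨{ toFun := fun t => p ((t : ℝ) * V 1)
            continuous_toFun := hlip'.continuous
            source' := ?_
            target' := ?_ }, hlip'⟩
  · have := hpV 0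
    rw [hV0] at this
    simpa using this
  · simpa using hpV 1

theorem exists_lipschitz_path {x y : X} {K : ℝ≥0} (h : pathEDist x y < K) :
    ∃ δ : Path x y, LipschitzWith K δ := by
  obtain ⟨γ, hγ⟩ := iInf_lt_iff.1 h
  exact γ.exists_lipschitz hγ.le

end LipschitzPaths

/-! ### Maps out of discrete spaces, and passage to intrinsic metrics -/

section

variable {X Y Z : Type u} [EMetricSpace X] [EMetricSpace Y] [EMetricSpace Z]

/-- Every map from a discrete metric space is non-expansive. -/
def Contraction.ofDiscrete (hX : IsDiscreteMetric X) (f : X → Y) : Contraction X Y :=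
  ⟨f, fun x y => by
    by_cases h : x = y
    · simp [h]
    · simp [hX x y h]⟩

/-- Points of `X` can be moved independently. For `K` above the supremum distance, each `f x` is
joined to `g x` by a `K`-Lipschitz path; the common constant makes the assembled path of maps
`K`-Lipschitz. -/
theorem IsDiscreteMetric.pathEDist_contraction_eq (hX : IsDiscreteMetric X) (hY : IsPathMetric Y)
    (f g : Contraction X Y) : pathEDist f g = edist f g := by
  refine le_antisymm (le_of_forall_gt fun c hc => ?_) (edist_le_pathEDist f g)
  obtain ⟨K, hK, hKc⟩ := ENNReal.lt_iff_exists_nnreal_btwn.1 hc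
  refine lt_of_le_of_lt ?_ hKc
  have h : ∀ x, ∃ δ : Path (f.toFun x) (g.toFun x), LipschitzWith K δ := fun x =>
    exists_lipschitz_path
      ((hY _ _).symm.trans_le (Contraction.edist_apply_le f g x) |>.trans_lt hK)
  choose δ hδ using h
  have hl : LipschitzWith K fun t : I => Contraction.ofDiscrete hX fun x => δ x t :=
    fun s t => iSup_le fun x => hδ x s t
  let Δ : Path f g :=
    { toFun := fun t => Contraction.ofDiscrete hX fun x => δ x t
      continuous_toFun := hl.continuous
      source' := by ext x; exact (δ x).source
      target' := by ext x; exact (δ x).target }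
  exact pathEDist_le_of_lipschitz_path Δ hl

theorem IsDiscreteMetric.isPathMetric (hX : IsDiscreteMetric X) : IsPathMetric X := fun x y => by
  by_cases h : x = y
  · rw [h, edist_self, pathEDist_self]
  · exact le_antisymm (edist_le_pathEDist x y) (hX x y h ▸ le_top)

theorem IsDiscreteMetric.completeSpace (hX : IsDiscreteMetric X) : CompleteSpace X := by
  -- Distance below 1 forces equality, so a sequence controlled by the constant 1 is constant.
  refine EMetric.complete_of_convergent_controlled_sequences (fun _ => 1) (fun _ => one_pos)
    fun v hv => ⟨v 0, tendsto_const_nhds.congr fun n => ?_⟩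
  by_contra h
  have := hv 0 0 n le_rfl (Nat.zero_le n)
  simp [hX _ _ h] at this

/-- A non-expansive map from a path metric space is non-expansive for the intrinsic metric. -/
noncomputable def Contraction.toLengthSpace (hY : IsPathMetric Y) (f : Contraction Y Z) :
    Contraction Y (LengthSpace Z) :=
  ⟨f.toFun, fun x y => by
    rw [ENNReal.coe_one, one_mul, hY x y]
    exact pathEDist_le_of_lipschitz f.lipschitz x y⟩

/-- The identity map from the intrinsic metric to the original one. -/
noncomputable def Contraction.ofLengthSpace (Z : Type u) [EMetricSpace Z] :
    Contraction (LengthSpace Z) Z :=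
  ⟨fun z => z, fun x y => by
    rw [ENNReal.coe_one, one_mul]
    exact edist_le_pathEDist (X := Z) x y⟩

/-- A non-expansive map stays non-expansive for the intrinsic metrics. -/
noncomputable def Contraction.mapLengthSpace (f : Contraction Y Z) :
    Contraction (LengthSpace Y) (LengthSpace Z) :=
  ⟨f.toFun, fun x y => by
    rw [ENNReal.coe_one, one_mul]
    exact pathEDist_le_of_lipschitz f.lipschitz x y⟩

end

/-! ### Directed colimits of isometries -/

/-- Truncation keeps the distance function real-valued where distances are infinite. It serves as a
test function for isometric legs and for discreteness. -/
theorem lipschitzWith_toReal_min_edist {X : Type*} [PseudoEMetricSpace X] (x : X) (R : ℝ≥0) :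
    LipschitzWith 1 fun y : X => (min (edist x y) R).toReal := by
  have hfin : ∀ y : X, min (edist x y) R ≠ (⊤ : ℝ≥0∞) := fun y =>
    ne_top_of_le_ne_top ENNReal.coe_ne_top (min_le_right _ _)
  have hle : ∀ y z : X, min (edist x y) (R : ℝ≥0∞) ≤ min (edist x z) R + edist y z := by
    intro y z
    rw [min_add, edist_comm y z]
    exact min_le_min (edist_triangle _ _ _) le_self_add
  intro y z
  rw [ENNReal.coe_one, one_mul]
  by_cases h : edist y z = ⊤
  · simp [h]
  rw [edist_dist, Real.dist_eq]
  refine ENNReal.ofReal_le_of_le_toReal (abs_sub_le_iff.2 ⟨?_, ?_⟩)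
  · have := ENNReal.toReal_mono (ENNReal.add_ne_top.2 ⟨hfin z, h⟩) (hle y z)
    rw [ENNReal.toReal_add (hfin z) h] at this
    linarith
  · have := ENNReal.toReal_mono (ENNReal.add_ne_top.2 ⟨hfin y, edist_comm y z ▸ h⟩) (hle z y)
    rw [ENNReal.toReal_add (hfin y) (edist_comm y z ▸ h), edist_comm z y] at this
    linarith

theorem IsKappaDirected.exists_ge_ge {J : Type u} [PartialOrder J]
    (h : IsKappaDirected Cardinal.aleph0 J) (i j : J) : ∃ k, i ≤ k ∧ j ≤ k := by
  obtain ⟨k, hk⟩ := h {i, j} (Cardinal.lt_aleph0_iff_set_finite.2 (by simp))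
  exact ⟨k, hk (by simp), hk (by simp)⟩

theorem isKappaDirected_aleph0 {J : Type u} [PartialOrder J] [Nonempty J]
    (h : ∀ i j : J, ∃ k, i ≤ k ∧ j ≤ k) : IsKappaDirected Cardinal.aleph0 J := by
  intro S hS
  have : IsDirectedOrder J := ⟨h⟩
  exact (Cardinal.lt_aleph0_iff_set_finite.1 hS).bddAbove

namespace CPMet

/-- The underlying map of a morphism. -/
def fn {X Y : CPMet.{u}} (f : X ⟶ Y) : X.carrier → Y.carrier := Contraction.toFun f

theorem fn_lipschitz {X Y : CPMet.{u}} (f : X ⟶ Y) : LipschitzWith 1 (fn f) :=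
  Contraction.lipschitz f

theorem hom_ext {X Y : CPMet.{u}} {f g : X ⟶ Y} (h : ∀ x, fn f x = fn g x) : f = g :=
  Contraction.ext (funext h)

theorem fn_comp {X Y Z : CPMet.{u}} (f : X ⟶ Y) (g : Y ⟶ Z) (x : X.carrier) :
    fn (f ≫ g) x = fn g (fn f x) := rfl

/-- A complete metric space, with its intrinsic metric. -/
noncomputable def ofLength (Z : Type u) [EMetricSpace Z] [CompleteSpace Z] : CPMet.{u} where
  carrier := LengthSpace Z
  isPathMetric := LengthSpace.isPathMetric

/-- The morphism to a space with its intrinsic metric given by a non-expansive map. -/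
noncomputable def toLength {X : CPMet.{u}} {Z : Type u} [EMetricSpace Z] [CompleteSpace Z]
    (f : Contraction X.carrier Z) : X ⟶ ofLength Z :=
  show Contraction X.carrier (LengthSpace Z) from f.toLengthSpace X.isPathMetric

section Cocone

variable {J : Type u} [PartialOrder J] {F : J ⥤ CPMet.{u}}

/-- The underlying map of a leg of a cocone. -/
def leg (c : Cocone F) (j : J) : (F.obj j).carrier → c.pt.carrier := fn (c.ι.app j)

theorem leg_lipschitz (c : Cocone F) (j : J) : LipschitzWith 1 (leg c j) := fn_lipschitz _

theorem leg_map (c : Cocone F) {i j : J} (h : i ≤ j) (x : (F.obj i).carrier) :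
    leg c j (fn (F.map (homOfLE h)) x) = leg c i x := by
  have := c.w (homOfLE h)
  exact congrArg (fun f : F.obj i ⟶ c.pt => fn f x) this

theorem map_map {i j k : J} (h : i ≤ j) (h' : j ≤ k) (x : (F.obj i).carrier) :
    fn (F.map (homOfLE h')) (fn (F.map (homOfLE h)) x) = fn (F.map (homOfLE (h.trans h'))) x := by
  rw [← fn_comp, ← F.map_comp]
  rfl

/-- The cocone given by compatible non-expansive maps to a complete metric space. -/
noncomputable def lengthCocone {Z : Type u} [EMetricSpace Z] [CompleteSpace Z]
    (f : ∀ j, (F.obj j).carrier → Z) (hf : ∀ j, LipschitzWith 1 (f j))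
    (hc : ∀ (i j : J) (h : i ≤ j) (x : (F.obj i).carrier),
      f j (fn (F.map (homOfLE h)) x) = f i x) : Cocone F where
  pt := ofLength Z
  ι :=
    { app := fun j => toLength ⟨f j, hf j⟩
      naturality := fun i j h => hom_ext fun x => hc i j (leOfHom h) x }

/-- Compatible non-expansive maps to a complete metric space factor through the colimit. -/
theorem exists_desc {c : Cocone F} (hc : IsColimit c) {Z : Type u} [EMetricSpace Z]
    [CompleteSpace Z] (f : ∀ j, (F.obj j).carrier → Z) (hf : ∀ j, LipschitzWith 1 (f j))
    (hcomp : ∀ (i j : J) (h : i ≤ j) (x : (F.obj i).carrier),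
      f j (fn (F.map (homOfLE h)) x) = f i x) :
    ∃ g : Contraction c.pt.carrier Z, ∀ j x, g.toFun (leg c j x) = f j x := by
  -- `Z` need not be a path metric space, so the descent goes through its intrinsic metric.
  let s := lengthCocone f hf hcomp
  let d : Contraction c.pt.carrier (LengthSpace Z) := hc.desc s
  refine ⟨d.comp (Contraction.ofLengthSpace Z), fun j x => ?_⟩
  exact congrArg (fun g : F.obj j ⟶ s.pt => fn g x) (hc.fac s j)

/-- The legs factor through the closure `D` of their ranges. The induced map to `D` followed by the
inclusion agrees with the identity on all legs, hence is the identity. -/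
theorem dense_iUnion_range_leg {c : Cocone F} (hc : IsColimit c) :
    Dense (⋃ j, range (leg c j)) := by
  let D := closure (⋃ j, range (leg c j))
  have : CompleteSpace D := isClosed_closure.completeSpace_coe
  have hD : ∀ j x, leg c j x ∈ D := fun j x =>
    subset_closure (mem_iUnion.2 ⟨j, mem_range_self x⟩)
  obtain ⟨g, hg⟩ := exists_desc hc (fun j x => (⟨leg c j x, hD j x⟩ : D))
    (fun j x y => leg_lipschitz c j x y) (fun i j h x => Subtype.ext (leg_map c h x))
  let e : c.pt ⟶ c.pt := g.comp ⟨Subtype.val, LipschitzWith.subtype_val D⟩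
  have he : e = 𝟙 c.pt := hc.hom_ext fun j => hom_ext fun x => congrArg Subtype.val (hg j x)
  intro z
  have hz : ((g.toFun z : D) : c.pt.carrier) = z :=
    congrArg (fun f : c.pt ⟶ c.pt => fn f z) he
  rw [← hz]
  exact (g.toFun z).2

/-- The truncated distance from `x`, computed at any common later stage, is a compatible family of
non-expansive functions. It descends to the colimit and there separates the images of `x` and `y` by
`R`, for every finite `R` below their distance. -/
theorem isometry_leg (hJ : IsKappaDirected Cardinal.aleph0 J)
    (hF : ∀ (i j : J) (f : i ⟶ j), isometries (F.map f)) {c : Cocone F}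
    (hc : IsColimit c) (i : J) : Isometry (leg c i) := by
  have hFd : ∀ {j k : J} (h : j ≤ k) (x y : (F.obj j).carrier),
      edist (fn (F.map (homOfLE h)) x) (fn (F.map (homOfLE h)) y) = edist x y :=
    fun h x y => hF _ _ (homOfLE h) x y
  intro x y
  refine le_antisymm (by simpa using leg_lipschitz c i x y) (ENNReal.le_of_forall_nnreal_lt ?_)
  intro R hR
  choose k hik hjk using fun j => hJ.exists_ge_ge i j
  let dst : ∀ j, (F.obj j).carrier → ℝ≥0∞ := fun j z =>
    edist (fn (F.map (homOfLE (hik j))) x) (fn (F.map (homOfLE (hjk j))) z)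
  have hdst : ∀ {j l : J} (hi : i ≤ l) (hj : j ≤ l) (z : (F.obj j).carrier),
      dst j z = edist (fn (F.map (homOfLE hi)) x) (fn (F.map (homOfLE hj)) z) := by
    intro j l hi hj z
    obtain ⟨m, hkm, hlm⟩ := hJ.exists_ge_ge (k j) l
    rw [← hFd hlm, map_map, map_map]
    simp only [dst]
    rw [← hFd hkm, map_map, map_map]
  obtain ⟨g, hg⟩ := exists_desc hc (Z := ULift.{u} ℝ)
    (fun j z => ULift.up (min (dst j z) R).toReal)
    (fun j z z' => by
      refine (lipschitzWith_toReal_min_edist (fn (F.map (homOfLE (hik j))) x) R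
        (fn (F.map (homOfLE (hjk j))) z) (fn (F.map (homOfLE (hjk j))) z')).trans ?_
      rw [hFd])
    (fun j l h z => by
      rw [hdst (hik l) (hjk l), hdst (hik l) (h.trans (hjk l)), map_map])
  have h1 := g.lipschitz (leg c i x) (leg c i y)
  rw [hg, hg, hdst le_rfl le_rfl, hdst le_rfl le_rfl, hFd, hFd, edist_self, min_eq_right hR.le,
    ENNReal.coe_one, one_mul] at h1
  refine le_trans (le_of_eq ?_) h1
  rw [ULift.edist_up_up, edist_dist, Real.dist_eq]
  simp

/-- A cocone of isometries with jointly dense ranges over a directed diagram is a colimit. -/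
theorem nonempty_isColimit (hJ : IsKappaDirected Cardinal.aleph0 J) {c : Cocone F}
    (hi : ∀ j, Isometry (leg c j)) (hd : Dense (⋃ j, range (leg c j))) :
    Nonempty (IsColimit c) := by
  set U := ⋃ j, range (leg c j) with hU
  have hext : ∀ s : Cocone F, ∃ d : Contraction c.pt.carrier s.pt.carrier,
      ∀ j x, d.toFun (leg c j x) = leg s j x := by
    intro s
    have hpre : ∀ z : U, ∃ j x, leg c j x = z := fun z => by
      obtain ⟨j, x, hx⟩ := mem_iUnion.1 z.2
      exact ⟨j, x, hx⟩
    choose a b hab using hpre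
    -- Move both points to a common stage, where the leg of `c` is isometric and that of `s`
    -- non-expansive.
    have key : ∀ (i j : J) (x : (F.obj i).carrier) (y : (F.obj j).carrier),
        edist (leg s i x) (leg s j y) ≤ edist (leg c i x) (leg c j y) := by
      intro i j x y
      obtain ⟨k, hik, hjk⟩ := hJ.exists_ge_ge i j
      rw [← leg_map s hik, ← leg_map s hjk, ← leg_map c hik, ← leg_map c hjk, hi k]
      simpa using leg_lipschitz s k _ _
    let g : U → s.pt.carrier := fun z => leg s (a z) (b z)
    have hg : LipschitzWith 1 g := fun z w => by
      rw [ENNReal.coe_one, one_mul, Subtype.edist_eq, ← hab z, ← hab w]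
      exact key _ _ _ _
    have hdi : IsDenseInducing (Subtype.val : U → c.pt.carrier) := hd.isDenseInducing_val
    have hui : IsUniformInducing (Subtype.val : U → c.pt.carrier) :=
      isUniformEmbedding_subtype_val.isUniformInducing
    have hcont : Continuous (hdi.extend g) :=
      (uniformContinuous_uniformly_extend hui hdi.dense hg.uniformContinuous).continuous
    have hval : ∀ z : U, hdi.extend g z = g z := fun z =>
      hdi.extend_eq hg.continuous z
    have hlip : LipschitzOnWith 1 (hdi.extend g) U := fun z hz w hw => by
      have := hg ⟨z, hz⟩ ⟨w, hw⟩
      rwa [← hval, ← hval] at this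
    have hlip' := (lipschitzOnWith_closure_iff hcont.continuousOn).2 hlip
    rw [hd.closure_eq, lipschitzOnWith_univ] at hlip'
    refine ⟨⟨_, hlip'⟩, fun j x => ?_⟩
    let z : U := ⟨leg c j x, mem_iUnion.2 ⟨j, mem_range_self x⟩⟩
    -- The chosen preimage of `z` may differ from `x`, but both map to the same point of `c`, so
    -- `key` bounds the distance of their images by zero.
    refine (hval z).trans (edist_le_zero.1 ((key _ _ _ _).trans_eq ?_))
    rw [hab z, edist_self]
  choose d hdj using hext
  refine ⟨{ desc := d, fac := fun s j => hom_ext (hdj s j), uniq := fun s m hm => ?_ }⟩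
  refine hom_ext fun z => ?_
  have : EqOn (fn m) (fn (d s : c.pt ⟶ s.pt)) U := by
    rintro _ hz
    obtain ⟨j, x, rfl⟩ := mem_iUnion.1 hz
    exact (congrArg (fun f : F.obj j ⟶ s.pt => fn f x) (hm j)).trans (hdj s j x).symm
  exact congrFun (Continuous.ext_on hd (fn_lipschitz m).continuous
    (fn_lipschitz (d s : c.pt ⟶ s.pt)).continuous this) z

end Cocone

end CPMet

/-! ### Enriched generation -/

namespace CPMet

theorem isEnrichedGenerated_of_finite {X : CPMet.{u}} [Finite X.carrier]
    (hX : IsDiscreteMetric X.carrier) :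
    IsEnrichedGenerated isometries Cardinal.aleph0 X := by
  intro J _ hJ F hF
  refine ⟨fun {c} hc => nonempty_isColimit hJ (fun j => ?_) ?_⟩
  · intro f g
    have hl := isometry_leg hJ hF hc j
    let f' : Contraction X.carrier (F.obj j).carrier := f
    let g' : Contraction X.carrier (F.obj j).carrier := g
    let l : Contraction (F.obj j).carrier c.pt.carrier := c.ι.app j
    exact (hX.pathEDist_contraction_eq c.pt.isPathMetric (f'.comp l) (g'.comp l)).trans
      ((iSup_congr fun x => hl _ _).trans
        (hX.pathEDist_contraction_eq (F.obj j).isPathMetric f' g').symm)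
  · intro f
    refine EMetric.mem_closure_iff.2 fun ε hε => ?_
    obtain ⟨δ, hδ, hδε⟩ := exists_between hε
    have h1 : ∀ x : X.carrier, ∃ j y, edist (Contraction.toFun f x) (leg c j y) < δ := by
      intro x
      obtain ⟨_, hz, hd⟩ := EMetric.mem_closure_iff.1
        (dense_iUnion_range_leg hc (Contraction.toFun f x)) δ hδ
      obtain ⟨j, y, rfl⟩ := mem_iUnion.1 hz
      exact ⟨j, y, hd⟩
    choose a b hab using h1
    -- Finiteness of `X` enters here: the approximations of all values live at one stage.
    obtain ⟨k, hk⟩ := hJ (range a) (Cardinal.lt_aleph0_iff_set_finite.2 (finite_range a))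
    have hak : ∀ x, a x ≤ k := fun x => hk (mem_range_self x)
    let g : Contraction X.carrier (F.obj k).carrier :=
      Contraction.ofDiscrete hX fun x => fn (F.map (homOfLE (hak x))) (b x)
    refine ⟨_, mem_iUnion.2 ⟨k, mem_range_self (f := leg (X.enrichedHom.mapCocone c) k) g⟩, ?_⟩
    let f' : Contraction X.carrier c.pt.carrier := f
    let l : Contraction (F.obj k).carrier c.pt.carrier := c.ι.app k
    refine ((hX.pathEDist_contraction_eq c.pt.isPathMetric f' (g.comp l)).trans_le
      (iSup_le fun x => ?_)).trans_lt hδε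
    change edist (Contraction.toFun f x) (leg c k (fn (F.map (homOfLE (hak x))) (b x))) ≤ δ
    rw [leg_map]
    exact (hab x).le

/-- Maps from a generated object to a space exhausted by a directed family of subspaces are
approximated, for the intrinsic metric, by maps to members of the family. -/
theorem IsEnrichedGenerated.exists_pathEDist_lt {X : CPMet.{u}}
    (hX : IsEnrichedGenerated isometries Cardinal.aleph0 X) (C : CPMet.{u})
    {J : Type u} [PartialOrder J] (hJ : IsKappaDirected Cardinal.aleph0 J)
    {S : J → Set C.carrier} (hmono : Monotone S) (hclosed : ∀ j, IsClosed (S j))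
    (hpath : ∀ j, IsPathMetric (S j)) (hdense : Dense (⋃ j, S j))
    (f : Contraction X.carrier C.carrier) {ε : ℝ≥0∞} (hε : 0 < ε) :
    ∃ (j : J) (g : Contraction X.carrier C.carrier),
      (∀ x, g.toFun x ∈ S j) ∧ pathEDist f g < ε := by
  have hcomplete : ∀ j, CompleteSpace (S j) := fun j => (hclosed j).completeSpace_coe
  let F : J ⥤ CPMet.{u} :=
    { obj := fun j => { carrier := S j, isPathMetric := hpath j }
      map := fun {i j} h => (⟨inclusion (hmono (leOfHom h)), fun x y => by
        rw [ENNReal.coe_one, one_mul]; rfl⟩ : Contraction (S i) (S j)) }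
  let c : Cocone F :=
    { pt := C
      ι := { app := fun j => (⟨Subtype.val, LipschitzWith.subtype_val (S j)⟩ :
              Contraction (S j) C.carrier) } }
  have hleg : ∀ j, range (leg c j) = S j := fun j => Subtype.range_val
  obtain ⟨hc⟩ := nonempty_isColimit (c := c) hJ (fun j => isometry_subtype_coe)
    (by simpa only [hleg] using hdense)
  have := hX J hJ F (fun i j h x y => rfl)
  -- Density of the legs is all that is used of the preserved colimit.
  have hd := dense_iUnion_range_leg (isColimitOfPreserves X.enrichedHom hc)
  obtain ⟨_, hz, hlt⟩ := EMetric.mem_closure_iff.1 (hd f) ε hε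
  obtain ⟨j, g, rfl⟩ := mem_iUnion.1 hz
  exact ⟨j, leg (X.enrichedHom.mapCocone c) j g, fun x => (Contraction.toFun g x).2, hlt⟩

end CPMet

/-! ### Finite-distance components -/

/-- The relation of being at finite distance. -/
def finiteDistSetoid (X : Type u) [EMetricSpace X] : Setoid X where
  r x y := edist x y ≠ ⊤
  iseqv :=
    { refl := fun x => by simp
      symm := fun {x y} h => by rwa [edist_comm]
      trans := fun {x y z} h h' =>
        ne_top_of_le_ne_top (ENNReal.add_ne_top.2 ⟨h, h'⟩) (edist_triangle x y z) }

/-- The set of finite-distance components. -/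
def FiniteDistComponents (X : Type u) [EMetricSpace X] : Type u := Quotient (finiteDistSetoid X)

open Classical in
noncomputable instance (X : Type u) [EMetricSpace X] : EMetricSpace (FiniteDistComponents X) where
  edist a b := if a = b then 0 else ⊤
  edist_self a := if_pos rfl
  edist_comm a b := by simp only [eq_comm]
  edist_triangle a b c := by
    by_cases h : a = b
    · simp [h]
    · simp [h]
  eq_of_edist_eq_zero {a b} h := by
    by_contra hab
    simp [hab] at h

theorem FiniteDistComponents.isDiscreteMetric (X : Type u) [EMetricSpace X] :
    IsDiscreteMetric (FiniteDistComponents X) := fun _ _ h => if_neg h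

theorem IsDiscreteMetric.subtype {X : Type*} [EMetricSpace X] (hX : IsDiscreteMetric X)
    (S : Set X) : IsDiscreteMetric S := fun x y h => hX x y fun h' => h (Subtype.ext h')

/-- The map sending a point to its finite-distance component. -/
noncomputable def toFiniteDistComponents (X : Type u) [EMetricSpace X] :
    Contraction X (FiniteDistComponents X) :=
  ⟨fun x => Quotient.mk (finiteDistSetoid X) x, fun x y => by
    rw [ENNReal.coe_one, one_mul]
    by_cases h : edist x y = ⊤
    · exact h ▸ le_top
    · have hq : Quotient.mk (finiteDistSetoid X) x = Quotient.mk (finiteDistSetoid X) y :=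
        Quotient.sound h
      exact (if_pos hq).trans_le bot_le⟩

/-- A map within distance less than 1 of the surjection onto the components equals it, so an
approximation with values in a finite subset bounds the number of components. -/
theorem CPMet.IsEnrichedGenerated.finite_finiteDistComponents {X : CPMet.{u}}
    (hX : IsEnrichedGenerated isometries Cardinal.aleph0 X) :
    Finite (FiniteDistComponents X.carrier) := by
  set A := FiniteDistComponents X.carrier
  have hA : IsDiscreteMetric A := FiniteDistComponents.isDiscreteMetric X.carrier
  have := hA.completeSpace
  obtain ⟨j, g, hg, hlt⟩ := hX.exists_pathEDist_lt
    { carrier := A, isPathMetric := hA.isPathMetric } (J := Finset A)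
    (isKappaDirected_aleph0 fun i j => by
      classical exact ⟨i ∪ j, Finset.subset_union_left, Finset.subset_union_right⟩)
    (S := fun s => (s : Set A)) (fun s t h => Finset.coe_subset.2 h)
    (fun s => s.finite_toSet.isClosed) (fun s => (hA.subtype _).isPathMetric)
    (fun a => subset_closure (mem_iUnion.2 ⟨{a}, by simp⟩))
    (toFiniteDistComponents X.carrier) one_pos
  refine Set.finite_univ_iff.1 (j.finite_toSet.subset ?_)
  rintro ⟨x⟩ -
  have h1 := (Contraction.edist_apply_le (toFiniteDistComponents X.carrier) g x).trans_lt
    ((edist_le_pathEDist _ _).trans_lt hlt)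
  have h2 : (toFiniteDistComponents X.carrier).toFun x = g.toFun x := by
    by_contra h
    rw [hA _ _ h] at h1
    exact absurd h1 (by simp)
  exact mem_of_eq_of_mem h2 (hg x)

/-! ### Lifting homotopies of circle-valued maps -/

section Lift

/-- The representative in `(-p/2, p/2]` is continuous away from the antipode of zero, which the norm
bound excludes. -/
theorem AddCircle.exists_continuous_lift {p : ℝ} [hp : Fact (0 < p)] {X : Type*} [TopologicalSpace X]
    {u : X → AddCircle p}
    (hu : Continuous u) (hlt : ∀ x, ‖u x‖ < p / 2) :
    ∃ δ : X → ℝ, Continuous δ ∧ ∀ x, (δ x : AddCircle p) = u x ∧ |δ x| = ‖u x‖ := by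
  have hp0 : 0 < p := hp.out
  let δ : X → ℝ := fun x => AddCircle.equivIoc p (-(p / 2)) (u x)
  have hcoe : ∀ x, (δ x : AddCircle p) = u x := fun x =>
    (AddCircle.equivIoc p (-(p / 2))).symm_apply_apply (u x)
  refine ⟨δ, ?_, fun x => ⟨hcoe x, ?_⟩⟩
  · rw [continuous_iff_continuousAt]
    intro x
    refine continuousAt_subtype_val.comp (ContinuousAt.comp
      (AddCircle.continuousAt_equivIoc p (-(p / 2)) fun h => ?_) hu.continuousAt)
    have h1 := hlt x
    rw [h, (AddCircle.norm_coe_eq_abs_iff p hp0.ne').2 (by rw [abs_neg, abs_of_pos hp0,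
      abs_of_pos (half_pos hp0)]), abs_neg, abs_of_pos (half_pos hp0)] at h1
    exact h1.false
  · have h := (AddCircle.equivIoc p (-(p / 2)) (u x)).2
    rw [← hcoe x, (AddCircle.norm_coe_eq_abs_iff p hp0.ne').2]
    rw [abs_of_pos hp0, abs_le]
    exact ⟨h.1.le, by linarith [h.2]⟩

theorem AddCircle.eq_of_coe_eq_zero {p : ℝ} {g : I → ℝ} (hg : Continuous g)
    (h : ∀ t, (g t : AddCircle p) = 0) : g 0 = g 1 := by
  have hT : DiscreteTopology (AddSubgroup.zmultiples p) := inferInstance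
  refine IsPreconnected.constant_of_mapsTo (S := univ) (T := (AddSubgroup.zmultiples p : Set ℝ))
    isPreconnected_univ ⟨hT⟩ hg.continuousOn (fun t _ => ?_) (mem_univ _) (mem_univ _)
  exact (QuotientAddGroup.eq_zero_iff _).1 (h t)

variable {p : ℝ} [hp : Fact (0 < p)] {X : Type u} [EMetricSpace X]

theorem Contraction.norm_down_sub_le {E : Type} [NormedAddCommGroup E]
    (f g : Contraction X (ULift.{u} E)) {η : ℝ≥0} (h : edist f g ≤ η) (x : X) :
    ‖(g.toFun x).down - (f.toFun x).down‖ ≤ η := by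
  have h1 := (Contraction.edist_apply_le f g x).trans h
  rw [ULift.edist_eq, edist_comm, edist_nndist, ENNReal.coe_le_coe] at h1
  rw [← dist_eq_norm]
  exact h1

/-- Each consecutive difference stays below half the circumference and so lifts; the lifts are
added. The total bound `n * η` may far exceed `p`. -/
theorem Contraction.exists_lift_of_chain (v : ℕ → Contraction X (ULift.{u} (AddCircle p)))
    {η : ℝ≥0} (hη : (η : ℝ) < p / 2) (hv : ∀ n, edist (v n) (v (n + 1)) ≤ η) (n : ℕ) :
    ∃ δ : X → ℝ, Continuous δ ∧ ∀ x, |δ x| ≤ n * η ∧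
      (δ x : AddCircle p) = ((v n).toFun x).down - ((v 0).toFun x).down := by
  induction n with
  | zero => exact ⟨fun _ => 0, continuous_const, fun x => by simp⟩
  | succ n ih =>
    obtain ⟨δ, hc, hδ⟩ := ih
    have hcont : ∀ n, Continuous fun x => ((v n).toFun x).down := fun n =>
      continuous_uliftDown.comp (v n).lipschitz.continuous
    have hle := Contraction.norm_down_sub_le _ _ (hv n)
    obtain ⟨δ', hc', hδ'⟩ := AddCircle.exists_continuous_lift ((hcont (n + 1)).sub (hcont n))
      fun x => (hle x).trans_lt hη
    refine ⟨fun x => δ x + δ' x, hc.add hc', fun x => ⟨?_, ?_⟩⟩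
    · refine (abs_add_le _ _).trans ?_
      have := (hδ x).1
      have h2 : |δ' x| ≤ η := (hδ' x).2.trans_le (hle x)
      push_cast
      linarith
    · rw [AddCircle.coe_add, (hδ x).2, (hδ' x).1]
      simp

/-- A short path of circle-valued maps is a translation by a small real-valued function. -/
theorem Contraction.exists_lift_of_pathEDist_lt {f g : Contraction X (ULift.{u} (AddCircle p))}
    {K : ℝ≥0} (h : pathEDist f g < K) :
    ∃ δ : X → ℝ, Continuous δ ∧ ∀ x, |δ x| ≤ K ∧
      (δ x : AddCircle p) = (g.toFun x).down - (f.toFun x).down := by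
  obtain ⟨γ, hγ⟩ := exists_lipschitz_path h
  have hp0 : 0 < p := hp.out
  obtain ⟨N, hN⟩ := exists_nat_gt (K / (p / 2) : ℝ)
  have hN0 : (0 : ℝ) < N := lt_of_le_of_lt (by positivity) hN
  have hη : ((K / N : ℝ≥0) : ℝ) < p / 2 := by
    rw [NNReal.coe_div, NNReal.coe_natCast, div_lt_iff₀ hN0]
    rwa [div_lt_iff₀ (half_pos hp0), mul_comm] at hN
  -- Sampling at multiples of `1 / N`, constant after `N`, makes each step at most `K / N < p / 2`.
  let s : ℕ → I := fun n => projIcc 0 1 zero_le_one (n / N : ℝ)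
  have hs : ∀ n, edist (γ (s n)) (γ (s (n + 1))) ≤ ((K / N : ℝ≥0) : ℝ≥0∞) := by
    intro n
    refine (hγ _ _).trans ?_
    rw [div_eq_mul_inv, ENNReal.coe_mul]
    gcongr
    refine (LipschitzWith.projIcc (zero_le_one (α := ℝ)) _ _).trans ?_
    rw [ENNReal.coe_one, one_mul, edist_nndist, ENNReal.coe_le_coe, ← NNReal.coe_le_coe,
      coe_nndist, Real.dist_eq, ← sub_div, Nat.cast_succ, sub_add_cancel_left, abs_div, abs_neg,
      abs_one, abs_of_pos hN0, one_div]
    simp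
  obtain ⟨δ, hc, hδ⟩ := Contraction.exists_lift_of_chain (fun n => γ (s n)) hη hs N
  have h0 : s 0 = 0 := by simp [s]
  have h1 : s N = 1 := by simp [s, hN0.ne']
  refine ⟨δ, hc, fun x => ⟨?_, ?_⟩⟩
  · refine (hδ x).1.trans (le_of_eq ?_)
    rw [NNReal.coe_div, NNReal.coe_natCast, mul_div_cancel₀ _ hN0.ne']
  · simpa [h0, h1] using (hδ x).2

end Lift

/-! ### An infinite torus -/

/-- A null sequence of circumferences. -/
noncomputable def circumference (n : ℕ) : ℝ := 1 / (n + 1)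

instance (n : ℕ) : Fact (0 < circumference n) := ⟨by unfold circumference; positivity⟩

theorem circumference_anti {m n : ℕ} (h : m ≤ n) : circumference n ≤ circumference m := by
  unfold circumference
  gcongr

/-- The product of circles with circumferences tending to zero, with the supremum distance. -/
abbrev Torus : Type := lp (fun n => AddCircle (circumference n)) ∞

namespace Torus

/-- The point of the torus with given coordinates. -/
noncomputable def mk (x : ∀ n, AddCircle (circumference n)) : Torus :=
  ⟨x, memℓp_infty ⟨1, by
    rintro _ ⟨n, rfl⟩
    have h0 : 0 < circumference n := Fact.out
    have h1 := AddCircle.norm_le_half_period (circumference n) (x := x n) h0.ne'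
    have h2 := circumference_anti (Nat.zero_le n)
    rw [abs_of_pos h0] at h1
    have h3 : circumference 0 = 1 := by simp [circumference]
    change ‖x n‖ ≤ 1
    linarith⟩⟩

theorem mk_apply (x : ∀ n, AddCircle (circumference n)) (n : ℕ) : mk x n = x n := rfl

theorem edist_le {x y : Torus} {K : ℝ≥0∞} (h : ∀ n, edist (x n) (y n) ≤ K) : edist x y ≤ K := by
  by_cases hK : K = ⊤
  · rw [hK]
    exact le_top
  lift K to ℝ≥0 using hK
  rw [edist_nndist, ENNReal.coe_le_coe, ← NNReal.coe_le_coe, coe_nndist, dist_eq_norm]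
  refine lp.norm_le_of_forall_le K.2 fun n => ?_
  have := h n
  rw [edist_nndist, ENNReal.coe_le_coe, ← NNReal.coe_le_coe, coe_nndist, dist_eq_norm] at this
  exact this

theorem edist_apply_le (x y : Torus) (n : ℕ) : edist (x n) (y n) ≤ edist x y := by
  rw [edist_nndist, edist_nndist, ENNReal.coe_le_coe, ← NNReal.coe_le_coe, coe_nndist, coe_nndist,
    dist_eq_norm, dist_eq_norm]
  exact lp.norm_apply_le_norm ENNReal.top_ne_zero (x - y) n

/-- The coordinate projections. -/
noncomputable def proj (n : ℕ) :
    Contraction (ULift.{u} Torus) (ULift.{u} (AddCircle (circumference n))) :=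
  ⟨fun x => ⟨x.down n⟩, fun x y => by
    rw [ENNReal.coe_one, one_mul]
    exact edist_apply_le x.down y.down n⟩

/-- The retraction onto the product of the first `j` circles. -/
noncomputable def trunc (j : ℕ) : Contraction (ULift.{u} Torus) (ULift.{u} Torus) :=
  ⟨fun x => ⟨mk fun n => if n < j then x.down n else 0⟩, fun x y => by
    rw [ENNReal.coe_one, one_mul]
    refine edist_le (x := mk _) (y := mk _) fun n => ?_
    rw [mk_apply, mk_apply]
    split_ifs
    · exact edist_apply_le x.down y.down n
    · simp⟩

theorem trunc_apply (j : ℕ) (x : ULift.{u} Torus) (n : ℕ) :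
    ((trunc j).toFun x).down n = if n < j then x.down n else 0 := rfl

theorem trunc_eq_self_iff {j : ℕ} {x : ULift.{u} Torus} :
    (trunc j).toFun x = x ↔ ∀ n, j ≤ n → x.down n = 0 := by
  constructor
  · intro h n hn
    rw [← h, trunc_apply, if_neg hn.not_gt]
  · intro h
    refine ULift.ext _ _ (lp.ext (funext fun n => ?_))
    rw [trunc_apply]
    split_ifs with hn
    · rfl
    · exact (h n (not_lt.1 hn)).symm

theorem trunc_trunc (j : ℕ) (x : ULift.{u} Torus) :
    (trunc j).toFun ((trunc j).toFun x) = (trunc j).toFun x :=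
  trunc_eq_self_iff.2 fun n hn => by rw [trunc_apply, if_neg hn.not_gt]

/-- All coordinates from `j` on slide to zero simultaneously, each along an arc no longer than the
`j`-th circumference. Since the circumferences tend to zero, the finite subproducts are dense even
for the intrinsic metric. -/
theorem pathEDist_trunc_le (j : ℕ) (x : ULift.{u} Torus) :
    pathEDist x ((trunc j).toFun x) ≤ ENNReal.ofReal (circumference j) := by
  have hy : ∀ n, ∃ y : ℝ, (y : AddCircle (circumference n)) = x.down n ∧
      |y| ≤ circumference n := by
    intro n
    have h := (AddCircle.equivIco (circumference n) 0 (x.down n)).2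
    refine ⟨_, (AddCircle.equivIco (circumference n) 0).symm_apply_apply (x.down n), ?_⟩
    rw [abs_of_nonneg h.1]
    exact h.2.le.trans_eq (zero_add _)
  choose y hy hyle using hy
  let g : I → ULift.{u} Torus := fun t =>
    ⟨mk fun n => if n < j then x.down n else (((1 - t) * y n : ℝ) : AddCircle (circumference n))⟩
  have hg : LipschitzWith (circumference j).toNNReal g := fun s t => by
    refine edist_le (x := mk _) (y := mk _) fun n => ?_
    rw [mk_apply, mk_apply]
    split_ifs with hn
    · simp
    · have h0 : 0 < circumference j := Fact.out
      have h1 : ‖((((1 - s) * y n : ℝ) : AddCircle (circumference n)) - ((1 - t) * y n : ℝ))‖ ≤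
          |(1 - s) * y n - (1 - t) * y n| := by
        rw [← AddCircle.coe_sub]
        exact QuotientAddGroup.norm_mk_le_norm
      have h2 : |(1 - s) * y n - (1 - t) * y n| ≤ circumference j * |(s : ℝ) - t| := by
        rw [← sub_mul, abs_mul, mul_comm, sub_sub_sub_cancel_left, abs_sub_comm (t : ℝ)]
        gcongr
        exact (hyle n).trans (circumference_anti (not_lt.1 hn))
      rw [edist_dist, dist_eq_norm, edist_dist, ← ENNReal.ofReal, ← ENNReal.ofReal_mul h0.le,
        Subtype.dist_eq, Real.dist_eq]
      exact ENNReal.ofReal_le_ofReal (h1.trans h2)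
  refine pathEDist_le_of_lipschitz_path
    { toFun := g, continuous_toFun := hg.continuous, source' := ?_, target' := ?_ } hg
  · refine ULift.ext _ _ (lp.ext (funext fun n => ?_))
    change (if n < j then x.down n else _) = _
    simp [hy]
  · refine ULift.ext _ _ (lp.ext (funext fun n => ?_))
    rw [trunc_apply]
    change (if n < j then x.down n else _) = _
    simp

/-- A real-valued non-expansive function, read off in all the circles. -/
noncomputable def wrap {X : Type u} [EMetricSpace X] {r : X → ℝ} (hr : LipschitzWith 1 r) :
    Contraction X (ULift.{u} Torus) :=
  ⟨fun x => ⟨mk fun n => (r x : AddCircle (circumference n))⟩, fun x y => by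
    refine edist_le (x := mk _) (y := mk _) fun n => le_trans ?_ (hr x y)
    rw [mk_apply, mk_apply, edist_dist, edist_dist]
    refine ENNReal.ofReal_le_ofReal ?_
    rw [dist_eq_norm, dist_eq_norm, ← AddCircle.coe_sub]
    exact QuotientAddGroup.norm_mk_le_norm⟩

end Torus

/-! ### Generated objects are discrete -/

theorem IsPathMetric.of_retraction {C : Type*} [EMetricSpace C] (hC : IsPathMetric C) {S : Set C}
    {ρ : C → S} (hρ : LipschitzWith 1 ρ) (h : ∀ x : S, ρ x = x) : IsPathMetric S := fun x y => by
  refine le_antisymm (edist_le_pathEDist x y) ?_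
  have := pathEDist_le_of_lipschitz hρ (x : C) y
  rwa [h, h, ← hC] at this

namespace CPMet

theorem IsEnrichedGenerated.exists_trunc_eq {X : CPMet.{u}}
    (hX : IsEnrichedGenerated isometries Cardinal.aleph0 X)
    (f : Contraction X.carrier (ULift.{u} Torus)) {ε : ℝ≥0∞} (hε : 0 < ε) :
    ∃ (j : ℕ) (g : Contraction X.carrier (ULift.{u} Torus)),
      (∀ x, (Torus.trunc j).toFun (g.toFun x) = g.toFun x) ∧ pathEDist f g < ε := by
  let C : CPMet.{u} := ofLength (ULift.{u} Torus)
  let f' : Contraction X.carrier (LengthSpace (ULift.{u} Torus)) :=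
    f.toLengthSpace X.isPathMetric
  let ρ : ℕ → Contraction C.carrier C.carrier := fun j => (Torus.trunc j).mapLengthSpace
  -- As fixed sets of non-expansive retractions, the finite subproducts are closed and inherit the
  -- path metric property.
  let S : ULift.{u} ℕ → Set C.carrier := fun j => {x | (ρ j.down).toFun x = x}
  have hmem : ∀ j (x : C.carrier), (ρ j.down).toFun x ∈ S j := fun j x => Torus.trunc_trunc _ _
  obtain ⟨j, g, hg, hlt⟩ := hX.exists_pathEDist_lt C (J := ULift.{u} ℕ)
    (isKappaDirected_aleph0 fun i j => ⟨i ⊔ j, le_sup_left, le_sup_right⟩) (S := S)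
    (fun i j h x hx => Torus.trunc_eq_self_iff.2 fun n hn =>
      Torus.trunc_eq_self_iff.1 hx n (le_trans h hn))
    (fun j => isClosed_eq (ρ j.down).lipschitz.continuous continuous_id)
    (fun j => IsPathMetric.of_retraction (C := C.carrier) C.isPathMetric (ρ := fun x => ⟨_, hmem j x⟩)
      (fun x y => (ρ j.down).lipschitz x y) (fun x => Subtype.ext x.2))
    (fun x => EMetric.mem_closure_iff.2 fun δ hδ => by
      have hz : Tendsto (fun n => ENNReal.ofReal (circumference n)) atTop (𝓝 0) := by
        rw [← ENNReal.ofReal_zero]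
        exact ENNReal.tendsto_ofReal tendsto_one_div_add_atTop_nhds_zero_nat
      obtain ⟨n, hn⟩ := (hz.eventually_lt_const hδ).exists
      exact ⟨_, mem_iUnion.2 ⟨⟨n⟩, hmem ⟨n⟩ x⟩,
        (Torus.pathEDist_trunc_le n (show ULift.{u} Torus from x)).trans_lt hn⟩)
    f' hε
  let g' : Contraction X.carrier (LengthSpace (ULift.{u} Torus)) := g
  refine ⟨j.down, g'.comp (Contraction.ofLengthSpace _), hg, lt_of_le_of_lt ?_ hlt⟩
  exact pathEDist_le_of_lipschitz
    (Contraction.lipschitz_postcomp (Contraction.ofLengthSpace (ULift.{u} Torus)))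
    f' g'

theorem IsEnrichedGenerated.isDiscreteMetric {X : CPMet.{u}}
    (hX : IsEnrichedGenerated isometries Cardinal.aleph0 X) : IsDiscreteMetric X.carrier := by
  intro p q hpq
  by_contra htop
  obtain ⟨R, hR⟩ := WithTop.ne_top_iff_exists.1 htop
  change (R : ℝ≥0∞) = edist p q at hR
  have hR0 : 0 < R := by
    rw [← ENNReal.coe_pos, hR]
    exact edist_pos.2 hpq
  let r : X.carrier → ℝ := fun x => (min (edist p x) R).toReal
  have hr : LipschitzWith 1 r := lipschitzWith_toReal_min_edist p R
  -- With tolerance `R / 4`, the corrections at `p` and `q` differ by at most `R / 2`, too little to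
  -- offset the change `R` of `r`.
  obtain ⟨j, g, hg, hlt⟩ := hX.exists_trunc_eq (Torus.wrap hr) (ε := ((R / 4 : ℝ≥0) : ℝ≥0∞))
    (ENNReal.coe_pos.2 (by positivity))
  have hlt' := (pathEDist_le_of_lipschitz
    (Contraction.lipschitz_postcomp (Torus.proj.{u} j)) (Torus.wrap hr) g).trans_lt hlt
  obtain ⟨δ, hδc, hδ⟩ := Contraction.exists_lift_of_pathEDist_lt hlt'
  have hsum : ∀ x, ((r x + δ x : ℝ) : AddCircle (circumference j)) = 0 := fun x => by
    have h0 : (g.toFun x).down j = 0 := Torus.trunc_eq_self_iff.1 (hg x) j le_rfl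
    have h1 : (δ x : AddCircle (circumference j)) = (g.toFun x).down j - (r x : ℝ) := (hδ x).2
    rw [AddCircle.coe_add, h1, h0]
    simp
  -- Finite distance in a path metric space yields a path from `p` to `q`; its length plays no role.
  rw [X.isPathMetric p q] at htop
  obtain ⟨γ, -⟩ := iInf_lt_iff.1 (lt_top_iff_ne_top.2 htop)
  have heq := AddCircle.eq_of_coe_eq_zero
    ((hr.continuous.add hδc).comp γ.continuous) fun t => hsum (γ t)
  have hp : r p = 0 := by simp [r]
  have hq : r q = R := by simp [r, ← hR]
  simp only [Function.comp, Pi.add_apply, γ.source, γ.target, hp, hq] at heq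
  have h1 := abs_le.1 (hδ p).1
  have h2 := abs_le.1 (hδ q).1
  have h3 : (0 : ℝ) < R := hR0
  push_cast at h1 h2
  linarith [h1.2, h2.1]

end CPMet

theorem mainTheorem2 (X : Type*) [EMetricSpace X] :
    (∃ (hc : CompleteSpace X) (hp : IsPathMetric X),
      CPMet.IsEnrichedGenerated CPMet.isometries Cardinal.aleph0
        (CPMet.mk (carrier := X) (complete := hc) hp)) ↔
      Finite X ∧ IsDiscreteMetric X := by
  constructor
  · rintro ⟨hc, hp, hX⟩
    have hd : IsDiscreteMetric X := hX.isDiscreteMetric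
    have hfin : Finite (FiniteDistComponents X) := hX.finite_finiteDistComponents
    refine ⟨Finite.of_injective (toFiniteDistComponents X).toFun fun x y h => ?_, hd⟩
    by_contra hxy
    have h' : edist x y ≠ ⊤ := Quotient.exact h
    exact h' (hd x y hxy)
  · rintro ⟨hfin, hd⟩
    exact ⟨hd.completeSpace, hd.isPathMetric, CPMet.isEnrichedGenerated_of_finite hd⟩
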